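/- For a permutation $\sigma=\sigma_1\cdots\sigma_n$ of $[n]=\{1,\dots,n\}$, say that $\sigma$ has an alternating descent at position $i\in\{1,\dots,n-1\}$ if either $i$ is odd and $\sigma_i>\sigma_{i+1}$, or $i$ is even and $\sigma_i<\sigma_{i+1}$. Let $\hat d(\sigma)$ be the number of alternating descents of $\sigma$, and for $n\ge 1$ let $$\hat A_n(t)=\sum_{\sigma\in\mathfrak S_n}t^{\hat d(\sigma)+1}$$ be the $n$-th alternating Eulerian polynomial. Then, as formal power series in $u$ over the field $\mathbb Q(t)$, $$\sum_{n\ge 1}\hat A_n(t)\,\frac{u^n}{n!}=\frac{t\,\bigl(1-\tan(u(t-1))-\sec(u(t-1))\bigr)}{\tan(u(t-1))+\sec(u(t-1))-t},$$ where $\tan$ and $\sec$ denote their Maclaurin series, and the denominator is invertible in $\mathbb Q(t)[[u]]$. -/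

import Mathlib

namespace AltEulerian

/-- A permutation `σ` of `Fin n` stands for the word `σ_1 ⋯ σ_n`, whose letter `σ_i` (with
`1 ≤ i ≤ n`) is the value of `σ` at the index `i - 1`.  The word has an alternating descent at the
position `i`, where `1 ≤ i ≤ n - 1`, if `i` is odd and `σ_i > σ_{i+1}`, or `i` is even and
`σ_i < σ_{i+1}`. -/
def IsAltDescent {n : ℕ} (σ : Equiv.Perm (Fin n)) (i : ℕ) : Prop :=
  ∃ (_ : 1 ≤ i) (h : i < n),
    (Odd i ∧ σ ⟨i - 1, (Nat.sub_le i 1).trans_lt h⟩ > σ ⟨i, h⟩) ∨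
    (Even i ∧ σ ⟨i - 1, (Nat.sub_le i 1).trans_lt h⟩ < σ ⟨i, h⟩)

instance {n : ℕ} (σ : Equiv.Perm (Fin n)) (i : ℕ) : Decidable (IsAltDescent σ i) := by
  unfold IsAltDescent
  infer_instance

/-- The alternating descent set of `σ`, a subset of `{1, …, n - 1}`. -/
def altDescentSet {n : ℕ} (σ : Equiv.Perm (Fin n)) : Finset ℕ :=
  (Finset.Icc 1 (n - 1)).filter (fun i => IsAltDescent σ i)

/-- The number of alternating descents of `σ`. -/
def altDes {n : ℕ} (σ : Equiv.Perm (Fin n)) : ℕ :=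
  (altDescentSet σ).card

/-- The alternating Eulerian polynomial `∑_σ t ^ (altDes σ + 1)`, summed over all permutations of
`n` letters. -/
noncomputable def altEulerianPoly (n : ℕ) : Polynomial ℚ :=
  ∑ σ : Equiv.Perm (Fin n), Polynomial.X ^ (altDes σ + 1)

/-- The exponential generating function `∑_{n ≥ 1} Â_n(t) u ^ n / n!` of the alternating Eulerian
polynomials, as a formal power series in `u` over the field `ℚ(t)`. -/
noncomputable def altEulerianEGF : PowerSeries (RatFunc ℚ) :=
  PowerSeries.mk fun n =>
    if n = 0 then 0
    else algebraMap (Polynomial ℚ) (RatFunc ℚ) (altEulerianPoly n) / (n.factorial : RatFunc ℚ)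

/-- The formal power series `sec x = 1 / cos x`; the constant coefficient of `cos x` is `1`. -/
noncomputable def secSeries (K : Type*) [Field K] [Algebra ℚ K] : PowerSeries K :=
  (PowerSeries.cos K)⁻¹

/-- The formal power series `tan x = sin x / cos x`. -/
noncomputable def tanSeries (K : Type*) [Field K] [Algebra ℚ K] : PowerSeries K :=
  PowerSeries.sin K * (PowerSeries.cos K)⁻¹

/-- The formal power series `tan (u (t - 1)) + sec (u (t - 1))` in `u` over `ℚ(t)`, with `t` the
generator `RatFunc.X` of `ℚ(t)`; `PowerSeries.rescale a f` is `f (a u)`. -/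
noncomputable def tanAddSec : PowerSeries (RatFunc ℚ) :=
  PowerSeries.rescale (RatFunc.X - 1 : RatFunc ℚ) (tanSeries (RatFunc ℚ)) +
    PowerSeries.rescale (RatFunc.X - 1 : RatFunc ℚ) (secSeries (RatFunc ℚ))

end AltEulerian

namespace AltEulerian

/-! ### The differential equation for tan + sec -/

section Series

open PowerSeries

variable {K : Type*} [Field K] [Algebra ℚ K]

/-! Let `a_n` be the sum of `t ^ altDes σ` over permutations of `n` letters. Cut a word at its
largest or smallest letter: the two adjacent positions have opposite parity and opposite
comparisons, so both are alternating descents or neither is, depending on the parity of the cut and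
on the choice of extremum (`altCount_append_cons`). The pieces contribute independently of their
starting parity (`altSum_eq_of_card_eq`). Adding the two recurrences removes the parity and leaves
the weight `1 + t ^ 2`, corrected at the ends of the word (`two_mul_altCoeff_succ`). So `G = ∑ a_n u
^ n / n!` solves a Riccati equation, and so does `E = tanAddSec`; uniqueness for a linear equation
then gives `G * (t - E) = t - 1`, which is the theorem since the required series is `t * (G - 1)`.
-/

lemma derivative_rescale {R : Type*} [CommRing R] (a : R) (f : PowerSeries R) :
    d⁄dX R (rescale a f) = C a * rescale a (d⁄dX R f) := by
  ext n
  simp only [coeff_derivative, coeff_rescale, coeff_C_mul]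
  ring

lemma derivative_sinSeries (K : Type*) [Field K] [Algebra ℚ K] :
    d⁄dX K (PowerSeries.sin K) = PowerSeries.cos K := by
  have := algebraRat.charZero K
  ext n
  have h : (n : K) + 1 ≠ 0 := by exact_mod_cast n.succ_ne_zero
  have h' : (n.factorial : K) ≠ 0 := by exact_mod_cast n.factorial_ne_zero
  rw [coeff_derivative]
  rcases Nat.even_or_odd n with hn | hn
  · have h1 : ¬ Even (n + 1) := by simpa [Nat.even_add_one] using hn
    have h2 : (n + 1) / 2 = n / 2 := by grind
    simp [PowerSeries.sin, PowerSeries.cos, hn, h1, h2, Nat.factorial_succ]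
    field_simp
  · have h1 : Even (n + 1) := hn.add_one
    simp [PowerSeries.sin, PowerSeries.cos, Nat.not_even_iff_odd.2 hn, h1]

lemma derivative_cosSeries (K : Type*) [Field K] [Algebra ℚ K] :
    d⁄dX K (PowerSeries.cos K) = -PowerSeries.sin K := by
  have := algebraRat.charZero K
  ext n
  have h : (n : K) + 1 ≠ 0 := by exact_mod_cast n.succ_ne_zero
  have h' : (n.factorial : K) ≠ 0 := by exact_mod_cast n.factorial_ne_zero
  rw [coeff_derivative]
  rcases Nat.even_or_odd n with hn | hn
  · have h1 : ¬ Even (n + 1) := by simpa [Nat.even_add_one] using hn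
    simp [PowerSeries.sin, PowerSeries.cos, hn, h1]
  · have h1 : Even (n + 1) := hn.add_one
    have h2 : (n + 1) / 2 = n / 2 + 1 := by grind
    simp [PowerSeries.sin, PowerSeries.cos, Nat.not_even_iff_odd.2 hn, h1, h2,
      Nat.factorial_succ, pow_succ]
    field_simp

lemma constantCoeff_sinSeries : constantCoeff (PowerSeries.sin K) = 0 := by
  simp [← coeff_zero_eq_constantCoeff_apply, PowerSeries.sin]

lemma constantCoeff_cosSeries : constantCoeff (PowerSeries.cos K) = 1 := by
  simp [← coeff_zero_eq_constantCoeff_apply, PowerSeries.cos]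

lemma sinSeries_sq_add_cosSeries_sq (K : Type*) [Field K] [Algebra ℚ K] :
    PowerSeries.sin K ^ 2 + PowerSeries.cos K ^ 2 = 1 := by
  have := algebraRat.charZero K
  apply derivative.ext
  · simp only [map_add, derivative_pow, derivative_sinSeries, derivative_cosSeries,
      derivative_one]
    ring
  · simp [constantCoeff_sinSeries, constantCoeff_cosSeries]

/-- `tan + sec` solves the differential equation `2 y' = 1 + y ^ 2`. -/
lemma two_mul_derivative_tanSeries_add_secSeries (K : Type*) [Field K] [Algebra ℚ K] :
    2 * d⁄dX K (tanSeries K + secSeries K) = 1 + (tanSeries K + secSeries K) ^ 2 := by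
  set S := tanSeries K + secSeries K with hS
  have hc : PowerSeries.cos K * (PowerSeries.cos K)⁻¹ = 1 :=
    PowerSeries.mul_inv_cancel _ (by simp [constantCoeff_cosSeries])
  have hc0 : PowerSeries.cos K ≠ 0 := by
    intro h
    simp [h] at hc
  have h1 : S * PowerSeries.cos K = PowerSeries.sin K + 1 := by
    rw [hS, tanSeries, secSeries]
    linear_combination (PowerSeries.sin K + 1) * hc
  have h2 := congrArg (d⁄dX K) h1
  simp only [Derivation.leibniz, smul_eq_mul, map_add, derivative_sinSeries,
    derivative_cosSeries, derivative_one, add_zero] at h2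
  have h3 := sinSeries_sq_add_cosSeries_sq K
  -- Multiplying by `cos ^ 2` leaves an identity that follows from `S * cos = sin + 1`, its
  -- derivative and `sin ^ 2 + cos ^ 2 = 1`.
  apply mul_right_cancel₀ (pow_ne_zero 2 hc0)
  linear_combination 2 * PowerSeries.cos K * h2 + h3 +
    (2 * PowerSeries.sin K - (S * PowerSeries.cos K + PowerSeries.sin K + 1)) * h1

lemma constantCoeff_rescale {R : Type*} [CommRing R] (a : R) (f : PowerSeries R) :
    constantCoeff (rescale a f) = constantCoeff f := by
  rw [← coeff_zero_eq_constantCoeff_apply, coeff_rescale, pow_zero, one_mul,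
    coeff_zero_eq_constantCoeff_apply]

lemma constantCoeff_tanAddSec : constantCoeff tanAddSec = 1 := by
  simp [tanAddSec, tanSeries, secSeries, constantCoeff_rescale, constantCoeff_sinSeries,
    constantCoeff_cosSeries]

lemma two_mul_derivative_tanAddSec :
    2 * d⁄dX (RatFunc ℚ) tanAddSec = (C RatFunc.X - 1) * (1 + tanAddSec ^ 2) := by
  have h := congrArg (rescale (RatFunc.X - 1 : RatFunc ℚ))
    (two_mul_derivative_tanSeries_add_secSeries (RatFunc ℚ))
  rw [tanAddSec, ← map_add, derivative_rescale]
  simp only [map_mul, map_add, map_pow, map_one, map_sub, map_ofNat] at h ⊢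
  linear_combination (C RatFunc.X - 1) * h

/-- A power series that solves a homogeneous linear differential equation and has no constant
term vanishes. -/
lemma eq_zero_of_derivative_eq_mul {R : Type*} [CommRing R] [IsDomain R] [CharZero R]
    {Z H : PowerSeries R} {m : ℕ} (hm : m ≠ 0) (hZ : (m : PowerSeries R) * d⁄dX R Z = Z * H)
    (h0 : constantCoeff Z = 0) : Z = 0 := by
  ext n
  induction n using Nat.strong_induction_on with
  | _ n ih =>
    rcases n with _ | n
    · simpa using h0
    -- Coefficient `n` of `Z * H` involves only coefficients of `Z` up to `n`, all zero by
    -- induction.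
    · have h := congrArg (coeff n) hZ
      rw [coeff_mul n Z H, Finset.sum_eq_zero, ← nsmul_eq_mul, map_nsmul, coeff_derivative] at h
      · have hn : (n : R) + 1 ≠ 0 := by exact_mod_cast n.succ_ne_zero
        simpa [hm, hn] using h
      · intro p hp
        rw [ih p.1 (by have := Finset.HasAntidiagonal.mem_antidiagonal.1 hp; omega)]
        simp

end Series

end AltEulerian

/-! ### Words and their splitting at an extremal letter -/

namespace AltEulerian

/-- The number of alternating descents of a word. The flag says whether the first position counts
as odd, that is, whether a descent (rather than an ascent) there is counted. -/
def altCount : Bool → List ℕ → ℕ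
  | _, [] => 0
  | _, [_] => 0
  | b, x :: y :: l => (if (if b then y < x else x < y) then 1 else 0) + altCount (!b) (y :: l)

/-- The flag of the position that lies `k` places after a position with flag `b`. -/
def flagAt (b : Bool) : ℕ → Bool
  | 0 => b
  | k + 1 => flagAt (!b) k

lemma flagAt_eq (b : Bool) (k : ℕ) : flagAt b k = if Even k then b else !b := by
  induction k generalizing b with
  | zero => simp [flagAt]
  | succ k ih =>
    rw [flagAt, ih]
    by_cases h : Even k <;> simp [h, Nat.even_add_one]

/-- The contribution of the two positions next to an extremal letter that has `k` letters to its
left and `j` letters to its right; `c` says whether these positions count. -/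
def peakCount (c : Bool) (k j : ℕ) : ℕ :=
  if c then (if k = 0 then 0 else 1) + (if j = 0 then 0 else 1) else 0

/-- Splitting a word at a letter that is the largest (`c = true`) or the smallest
(`c = false`) one. -/
lemma altCount_append_cons (c b : Bool) (l₁ l₂ : List ℕ) (m : ℕ)
    (h₁ : ∀ x ∈ l₁, cond c (x < m) (m < x)) (h₂ : ∀ x ∈ l₂, cond c (x < m) (m < x)) :
    altCount b (l₁ ++ m :: l₂) =
      altCount b l₁ + altCount (flagAt b (l₁.length + 1)) l₂ +
        peakCount (flagAt b l₁.length == c) l₁.length l₂.length := by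
  induction l₁ generalizing b with
  | nil =>
    rcases l₂ with _ | ⟨y, l₂⟩
    · simp [altCount, peakCount]
    · have hy := h₂ y (by simp)
      cases b <;> cases c <;> simp_all [altCount, flagAt, peakCount] <;> omega
  | cons x l₁ ih =>
    have ih' := ih (!b) (fun z hz => h₁ z (by simp [hz]))
    have hx := h₁ x (by simp)
    rcases l₁ with _ | ⟨y, l₁⟩
    · simp only [List.nil_append, List.cons_append, altCount, List.length_nil,
        List.length_cons] at ih' ⊢
      rw [ih']
      cases b <;> cases c <;> simp_all [flagAt, peakCount] <;> omega
    · simp only [List.cons_append, altCount, List.length_cons] at ih' ⊢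
      rw [ih']
      simp only [flagAt, peakCount]
      simp
      ring

/-- The words in which every element of `s` occurs exactly once and no other letter occurs. -/
def orderings (s : Finset ℕ) : Finset (List ℕ) :=
  ⟨s.val.lists, Multiset.lists_nodup_finset s⟩

lemma mem_orderings {s : Finset ℕ} {l : List ℕ} : l ∈ orderings s ↔ l.Nodup ∧ l.toFinset = s := by
  simp only [orderings, Finset.mem_mk, Multiset.mem_lists_iff]
  constructor
  · intro h
    have hl : l.Nodup := by
      have := s.nodup
      rw [h] at this
      exact this
    refine ⟨hl, Finset.val_injective ?_⟩
    rw [h, List.toFinset_val, hl.dedup]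
    rfl
  · rintro ⟨hl, rfl⟩
    rw [List.toFinset_val, hl.dedup]
    rfl

lemma length_of_mem_orderings {s : Finset ℕ} {l : List ℕ} (h : l ∈ orderings s) :
    l.length = s.card := by
  rw [mem_orderings] at h
  rw [← h.2, List.toFinset_card_of_nodup h.1]

lemma mem_iff_of_mem_orderings {s : Finset ℕ} {l : List ℕ} (h : l ∈ orderings s) (x : ℕ) :
    x ∈ l ↔ x ∈ s := by
  rw [mem_orderings] at h
  rw [← h.2, List.mem_toFinset]

/-- A word on `insert m s` is split by the letter `m` into two words on complementary subsets
of `s`. -/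
lemma sum_orderings_insert {M : Type*} [AddCommMonoid M] (f : List ℕ → M) {s : Finset ℕ} {m : ℕ}
    (hm : m ∉ s) :
    ∑ l ∈ orderings (insert m s), f l =
      ∑ A ∈ s.powerset, ∑ p ∈ orderings A ×ˢ orderings (s \ A), f (p.1 ++ m :: p.2) := by
  rw [Finset.sum_sigma']
  symm
  refine Finset.sum_bij (fun q _ => q.2.1 ++ m :: q.2.2) ?_ ?_ ?_ (fun _ _ => rfl)
  · rintro ⟨A, l₁, l₂⟩ h
    simp only [Finset.mem_sigma, Finset.mem_powerset, Finset.mem_product, mem_orderings] at h ⊢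
    obtain ⟨hA, ⟨h₁, h₁'⟩, h₂, h₂'⟩ := h
    have e₁ : ∀ x, x ∈ l₁ ↔ x ∈ A := fun x => by rw [← h₁', List.mem_toFinset]
    have e₂ : ∀ x, x ∈ l₂ ↔ x ∈ s \ A := fun x => by rw [← h₂', List.mem_toFinset]
    constructor
    · rw [List.nodup_middle, List.nodup_cons, List.nodup_append']
      refine ⟨?_, h₁, h₂, ?_⟩
      · simp only [List.mem_append, e₁, e₂, Finset.mem_sdiff]
        exact fun h => hm (h.elim (fun h => hA h) (fun h => h.1))
      · intro x hx hx'
        rw [e₁] at hx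
        rw [e₂, Finset.mem_sdiff] at hx'
        exact hx'.2 hx
    · ext x
      simp only [List.mem_toFinset, List.mem_append, List.mem_cons, e₁, e₂, Finset.mem_sdiff,
        Finset.mem_insert]
      have := @hA x
      tauto
  · rintro ⟨A, l₁, l₂⟩ h ⟨A', l₁', l₂'⟩ h' heq
    simp only [Finset.mem_sigma, Finset.mem_powerset, Finset.mem_product] at h h' heq
    obtain ⟨hA, h₁, h₂⟩ := h
    obtain ⟨hA', h₁', h₂'⟩ := h'
    have n₁ : m ∉ l₁ := fun hx => hm (hA ((mem_iff_of_mem_orderings h₁ m).1 hx))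
    have n₂ : m ∉ l₂ := fun hx =>
      hm (Finset.mem_sdiff.1 ((mem_iff_of_mem_orderings h₂ m).1 hx)).1
    obtain ⟨rfl, -, rfl⟩ := (List.append_cons_inj_of_notMem n₁ n₂).1 heq
    have : A = A' := (mem_orderings.1 h₁).2.symm.trans (mem_orderings.1 h₁').2
    subst this
    rfl
  · intro l hl
    have hml : m ∈ l := (mem_iff_of_mem_orderings hl m).2 (Finset.mem_insert_self m s)
    obtain ⟨l₁, l₂, rfl⟩ := List.append_of_mem hml
    rw [mem_orderings] at hl
    obtain ⟨hn, hs⟩ := hl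
    rw [List.nodup_middle, List.nodup_cons, List.nodup_append', List.mem_append] at hn
    obtain ⟨hm', n₁, n₂, hd⟩ := hn
    have hs' : ∀ x, (x ∈ l₁ ∨ x = m ∨ x ∈ l₂) ↔ x = m ∨ x ∈ s := fun x => by
      rw [← Finset.mem_insert, ← hs]
      simp only [List.mem_toFinset, List.mem_append, List.mem_cons]
    refine ⟨⟨l₁.toFinset, l₁, l₂⟩, ?_, rfl⟩
    simp only [Finset.mem_sigma, Finset.mem_powerset, Finset.mem_product, mem_orderings]
    refine ⟨?_, ⟨n₁, trivial⟩, n₂, ?_⟩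
    · intro x hx
      rw [List.mem_toFinset] at hx
      have := (hs' x).1 (Or.inl hx)
      have : x ≠ m := by rintro rfl; exact hm' (Or.inl hx)
      tauto
    · ext x
      have h3 := hs' x
      have h4 := @hd x
      have h5 : x = m → x ∉ s ∧ x ∉ l₁ ∧ x ∉ l₂ := by rintro rfl; tauto
      simp only [List.mem_toFinset, Finset.mem_sdiff]
      tauto

/-! ### Weighted sums over words and their quadratic recurrence -/

section Weights

variable {R : Type*} [CommRing R] (t : R)

/-- The generating polynomial of `altCount` over the words on `s`. -/
def altSum (b : Bool) (s : Finset ℕ) : R :=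
  ∑ l ∈ orderings s, t ^ altCount b l

lemma altSum_empty (b : Bool) : altSum t b ∅ = 1 := by
  have : orderings ∅ = {[]} := by
    ext l
    rw [mem_orderings]
    simp +contextual [List.toFinset_eq_empty_iff]
  simp [altSum, this, altCount]

lemma altSum_insert (c b : Bool) {s : Finset ℕ} {m : ℕ}
    (hm : ∀ x ∈ s, cond c (x < m) (m < x)) :
    altSum t b (insert m s) = ∑ A ∈ s.powerset,
      t ^ peakCount (flagAt b A.card == c) A.card (s.card - A.card) *
        (altSum t b A * altSum t (flagAt b (A.card + 1)) (s \ A)) := by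
  have hms : m ∉ s := fun h => by
    have := hm m h
    cases c <;> simp at this
  rw [altSum, sum_orderings_insert _ hms]
  refine Finset.sum_congr rfl fun A hA => ?_
  rw [Finset.mem_powerset] at hA
  rw [altSum, altSum, Finset.sum_mul_sum, ← Finset.sum_product', Finset.mul_sum]
  refine Finset.sum_congr rfl fun p hp => ?_
  rw [Finset.mem_product] at hp
  obtain ⟨h₁, h₂⟩ := hp
  rw [altCount_append_cons c b p.1 p.2 m
    (fun x hx => hm x (hA ((mem_iff_of_mem_orderings h₁ x).1 hx)))
    (fun x hx => hm x (Finset.mem_sdiff.1 ((mem_iff_of_mem_orderings h₂ x).1 hx)).1),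
    length_of_mem_orderings h₁, length_of_mem_orderings h₂, Finset.card_sdiff_of_subset hA]
  ring

/-- Any non-empty finite set has a largest and a smallest element. -/
lemma exists_insert_extremal (c : Bool) {s : Finset ℕ} (hs : s.Nonempty) :
    ∃ m u, s = insert m u ∧ u.card + 1 = s.card ∧ ∀ x ∈ u, cond c (x < m) (m < x) := by
  cases c
  · have h := s.min'_mem hs
    refine ⟨s.min' hs, s.erase (s.min' hs), (Finset.insert_erase h).symm,
      Finset.card_erase_add_one h, fun x hx => ?_⟩
    exact Finset.min'_lt_of_mem_erase_min' s hs hx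
  · have h := s.max'_mem hs
    refine ⟨s.max' hs, s.erase (s.max' hs), (Finset.insert_erase h).symm,
      Finset.card_erase_add_one h, fun x hx => ?_⟩
    exact Finset.lt_max'_of_mem_erase_max' s hs hx

/-- The weighted sum depends only on the number of letters, and not on the flag. -/
lemma altSum_eq_of_card_eq (b : Bool) (s : Finset ℕ) (b' : Bool) (s' : Finset ℕ)
    (h : s.card = s'.card) : altSum t b s = altSum t b' s' := by
  have key : ∀ n, ∃ a : R, ∀ b (s : Finset ℕ), s.card = n → altSum t b s = a := by
    intro n
    induction n using Nat.strong_induction_on with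
    | _ n ih =>
      choose! a ha using ih
      rcases n with _ | n
      · refine ⟨1, fun b s hs => ?_⟩
        rw [Finset.card_eq_zero] at hs
        subst hs
        exact altSum_empty t b
      · refine ⟨∑ k ∈ Finset.range (n + 1), n.choose k •
          (t ^ peakCount (flagAt true k == true) k (n - k) * (a k * a (n - k))),
          fun b s hs => ?_⟩
        -- Complementing the letters swaps the two flags; accordingly the cut is at the maximum for
        -- flag `true` and at the minimum for `false`.
        obtain ⟨m, u, rfl, hu, hm⟩ :=
          exists_insert_extremal b (Finset.card_pos.1 (by omega : 0 < s.card))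
        obtain rfl : u.card = n := by omega
        rw [altSum_insert t b b hm, ← Finset.sum_powerset_apply_card
          (fun k => t ^ peakCount (flagAt true k == true) k (u.card - k) *
            (a k * a (u.card - k)))]
        refine Finset.sum_congr rfl fun A hA => ?_
        rw [Finset.mem_powerset] at hA
        have hc := Finset.card_le_card hA
        rw [ha A.card (by omega) b A rfl, ha (u.card - A.card) (by omega) _ (u \ A)
          (Finset.card_sdiff_of_subset hA)]
        congr 3
        -- Whether `flagAt b k` equals `b` depends only on the parity of `k`.
        rw [flagAt_eq, flagAt_eq]
        split_ifs <;> cases b <;> rfl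
  obtain ⟨a, ha⟩ := key s.card
  rw [ha b s rfl, ha b' s' h.symm]

/-- The generating polynomial of the number of alternating descents of permutations of `n`
letters, without the extra factor. -/
def altCoeff (n : ℕ) : R :=
  altSum t true (Finset.range n)

lemma altSum_eq_altCoeff (b : Bool) (s : Finset ℕ) : altSum t b s = altCoeff t s.card :=
  altSum_eq_of_card_eq t b s true _ (by simp)

lemma altCoeff_zero : altCoeff t 0 = 1 :=
  altSum_empty t true

lemma altCoeff_succ (c : Bool) (n : ℕ) :
    altCoeff t (n + 1) = ∑ k ∈ Finset.range (n + 1), n.choose k •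
      (t ^ peakCount (flagAt true k == c) k (n - k) * (altCoeff t k * altCoeff t (n - k))) := by
  obtain ⟨m, u, hs, hu, hm⟩ :=
    exists_insert_extremal c (s := Finset.range (n + 1)) (by simp)
  obtain rfl : u.card = n := by simpa using hu
  have h : altCoeff t (u.card + 1) = altSum t true (insert m u) := by rw [altCoeff, hs]
  rw [h, altSum_insert t c true hm, ← Finset.sum_powerset_apply_card
    (fun k => t ^ peakCount (flagAt true k == c) k (u.card - k) *
      (altCoeff t k * altCoeff t (u.card - k)))]
  refine Finset.sum_congr rfl fun A hA => ?_
  rw [altSum_eq_altCoeff, altSum_eq_altCoeff,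
    Finset.card_sdiff_of_subset (Finset.mem_powerset.1 hA)]

/-- For each `k`, exactly one of the cuts at the maximum and at the minimum makes the adjacent
positions count. Interior cuts weigh `1 + t ^ 2`; an end cut weighs `1 + t`, whence the correction
`-t * (t - 1)` per end. For `n = 0` both ends coincide and the weight is `2`, whence `(t - 1) ^ 2`.
-/
lemma two_mul_altCoeff_succ (n : ℕ) :
    2 * altCoeff t (n + 1) = (1 + t ^ 2) *
        ∑ k ∈ Finset.range (n + 1), n.choose k • (altCoeff t k * altCoeff t (n - k)) -
      2 * t * (t - 1) * altCoeff t n + if n = 0 then (t - 1) ^ 2 else 0 := by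
  have h : 2 * altCoeff t (n + 1) = ∑ k ∈ Finset.range (n + 1),
      (1 + t ^ ((if k = 0 then 0 else 1) + (if n - k = 0 then 0 else 1))) *
        (n.choose k • (altCoeff t k * altCoeff t (n - k))) := by
    rw [two_mul]
    nth_rewrite 1 [altCoeff_succ t true]
    rw [altCoeff_succ t false, ← Finset.sum_add_distrib]
    refine Finset.sum_congr rfl fun k _ => ?_
    cases flagAt true k <;> simp [peakCount] <;> ring
  rw [h]
  rcases n with _ | n
  · simp [altCoeff_zero]
    ring
  · rw [Finset.sum_range_succ, Finset.sum_range_succ', Finset.sum_range_succ _ (n + 1),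
      Finset.sum_range_succ' _ n]
    have : ∀ k ∈ Finset.range n,
        (1 + t ^ ((if k + 1 = 0 then 0 else 1) + (if n + 1 - (k + 1) = 0 then 0 else 1))) *
          ((n + 1).choose (k + 1) • (altCoeff t (k + 1) * altCoeff t (n + 1 - (k + 1)))) =
        (1 + t ^ 2) *
          ((n + 1).choose (k + 1) • (altCoeff t (k + 1) * altCoeff t (n + 1 - (k + 1)))) := by
      intro k hk
      have : n + 1 - (k + 1) ≠ 0 := by have := Finset.mem_range.1 hk; omega
      rw [if_neg this, if_neg k.succ_ne_zero]
    rw [Finset.sum_congr rfl this, ← Finset.mul_sum]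
    simp [altCoeff_zero]
    ring

end Weights

/-! ### From permutations to words -/

lemma altCount_eq_card (b : Bool) (l : List ℕ) :
    altCount b l = ∑ i ∈ Finset.range (l.length - 1),
      if (if flagAt b i then l.getD (i + 1) 0 < l.getD i 0 else l.getD i 0 < l.getD (i + 1) 0)
        then 1 else 0 := by
  induction l generalizing b with
  | nil => simp [altCount]
  | cons x l ih =>
    rcases l with _ | ⟨y, l⟩
    · simp [altCount]
    · rw [altCount, ih]
      simp only [List.length_cons, Nat.add_sub_cancel]
      rw [Finset.sum_range_succ', add_comm]
      rfl

lemma altDes_eq_altCount {n : ℕ} (σ : Equiv.Perm (Fin n)) :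
    altDes σ = altCount true (List.ofFn fun i => (σ i : ℕ)) := by
  rw [altCount_eq_card, altDes, altDescentSet, Finset.card_filter, List.length_ofFn,
    ← Finset.Ico_succ_right_eq_Icc, Finset.sum_Ico_eq_sum_range]
  -- List index `i` is position `i + 1`, so even `i` means an odd position, with flag `true`.
  refine Finset.sum_congr (by simp) fun i hi => ?_
  rw [Finset.mem_range] at hi
  have h : i + 1 < n := by omega
  have h' : i < n := by omega
  simp [IsAltDescent, flagAt_eq, h, h', add_comm 1 i, List.getD_eq_getElem?_getD]
  by_cases hi : Even i <;> simp [hi, Nat.even_add_one, Nat.odd_add_one]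

lemma altCoeff_eq_sum_perm {R : Type*} [CommRing R] (t : R) (n : ℕ) :
    altCoeff t n = ∑ σ : Equiv.Perm (Fin n), t ^ altDes σ := by
  rw [altCoeff, altSum]
  symm
  refine Finset.sum_bij (fun σ _ => List.ofFn fun i => (σ i : ℕ)) ?_ ?_ ?_
    (fun σ _ => by rw [altDes_eq_altCount])
  · intro σ _
    rw [mem_orderings]
    constructor
    · rw [List.nodup_ofFn]
      exact Fin.val_injective.comp σ.injective
    · ext x
      simp only [List.mem_toFinset, List.mem_ofFn, Finset.mem_range]
      constructor
      · rintro ⟨i, rfl⟩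
        exact (σ i).2
      · intro hx
        exact ⟨σ.symm ⟨x, hx⟩, by simp⟩
  · intro σ _ τ _ h
    ext i
    exact congrFun (List.ofFn_injective h) i
  · intro l hl
    have hlen : l.length = n := by simpa using length_of_mem_orderings hl
    subst hlen
    -- The letters of `l` are below its length, so reading them off is an injective self-map of a
    -- finite type, hence a permutation.
    have hlt : ∀ i : Fin l.length, l.get i < l.length := fun i => by
      simpa using (mem_iff_of_mem_orderings hl _).1 (l.get_mem i)
    have hinj : Function.Injective fun i : Fin l.length => (⟨l.get i, hlt i⟩ : Fin l.length) :=
      fun i j h => (mem_orderings.1 hl).1.injective_get (congrArg Fin.val h)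
    refine ⟨Equiv.ofBijective _ (Finite.injective_iff_bijective.1 hinj), Finset.mem_univ _, ?_⟩
    simp

end AltEulerian

/-! ### The Riccati equation and its solution -/

namespace AltEulerian

open PowerSeries

/-- The exponential generating function of `altCoeff`, including the term for the empty word. -/
noncomputable def altCoeffEGF {K : Type*} [Field K] (t : K) : PowerSeries K :=
  PowerSeries.mk fun n => altCoeff t n / (n.factorial : K)

lemma coeff_altCoeffEGF_sq {K : Type*} [Field K] [CharZero K] (t : K) (n : ℕ) :
    coeff n (altCoeffEGF t ^ 2) =
      (∑ k ∈ Finset.range (n + 1), n.choose k • (altCoeff t k * altCoeff t (n - k))) /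
        (n.factorial : K) := by
  rw [sq, coeff_mul, Finset.Nat.sum_antidiagonal_eq_sum_range_succ_mk, Finset.sum_div]
  refine Finset.sum_congr rfl fun k hk => ?_
  have hk : k ≤ n := Nat.lt_succ_iff.1 (Finset.mem_range.1 hk)
  have h0 : ∀ m : ℕ, (m.factorial : K) ≠ 0 := fun m => by exact_mod_cast m.factorial_ne_zero
  have h1 := h0 n
  have h2 := h0 k
  have h3 := h0 (n - k)
  have h4 : (n.choose k : K) * k.factorial * (n - k).factorial = n.factorial := by
    exact_mod_cast Nat.choose_mul_factorial_mul_factorial hk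
  simp only [altCoeffEGF, coeff_mk, nsmul_eq_mul]
  field_simp
  linear_combination -(altCoeff t k * altCoeff t (n - k)) * h4

lemma two_mul_derivative_altCoeffEGF {K : Type*} [Field K] [CharZero K] (t : K) :
    2 * d⁄dX K (altCoeffEGF t) = C (1 + t ^ 2) * altCoeffEGF t ^ 2 -
      C (2 * t * (t - 1)) * altCoeffEGF t + C ((t - 1) ^ 2) := by
  ext n
  have h1 : (n.factorial : K) ≠ 0 := by exact_mod_cast n.factorial_ne_zero
  have h2 : (n : K) + 1 ≠ 0 := by exact_mod_cast n.succ_ne_zero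
  have h := two_mul_altCoeff_succ t n
  have e : (2 : PowerSeries K) = C 2 := (map_ofNat C 2).symm
  rw [e, map_add, map_sub, coeff_C_mul, coeff_C_mul, coeff_C_mul, coeff_altCoeffEGF_sq,
    coeff_derivative, coeff_C]
  simp only [altCoeffEGF, coeff_mk, Nat.factorial_succ, Nat.cast_mul, Nat.cast_add, Nat.cast_one]
  -- Only `n = 0` contributes, where `n! = 1`.
  have h3 : (if n = 0 then (t - 1) ^ 2 else 0) =
      (if n = 0 then (t - 1) ^ 2 else 0) / (n.factorial : K) := by
    split_ifs with hn
    · simp [hn]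
    · simp
  rw [h3]
  field_simp
  linear_combination h

lemma altCoeffEGF_mul_sub_tanAddSec :
    altCoeffEGF (RatFunc.X : RatFunc ℚ) * (C RatFunc.X - tanAddSec) = C RatFunc.X - 1 := by
  set G := altCoeffEGF (RatFunc.X : RatFunc ℚ) with hG
  set T : PowerSeries (RatFunc ℚ) := C RatFunc.X
  have hG' := two_mul_derivative_altCoeffEGF (RatFunc.X : RatFunc ℚ)
  have hE' := two_mul_derivative_tanAddSec
  rw [← hG] at hG'
  simp only [map_add, map_sub, map_mul, map_pow, map_one, map_ofNat] at hG'
  rw [← sub_eq_zero]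
  -- Both Riccati equations make twice the derivative of `Z = G * (T - E) - (T - 1)` divisible by
  -- `Z`; `H` is the cofactor.
  refine eq_zero_of_derivative_eq_mul (m := 2) two_ne_zero
    (H := (1 + T ^ 2) * G - (T - 1) * (T - tanAddSec)) ?_ ?_
  · simp only [map_sub, Derivation.leibniz, smul_eq_mul, derivative_one, T, derivative_C]
    push_cast
    linear_combination (T - tanAddSec) * hG' - G * hE'
  · have h0 : constantCoeff G = 1 := by
      rw [hG, ← coeff_zero_eq_constantCoeff_apply, altCoeffEGF, coeff_mk, altCoeff_zero]
      simp
    simp [h0, T, constantCoeff_tanAddSec]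

/-- Subtracting `1` drops the empty word; the factor `t` is the extra exponent in `altEulerianPoly`.
-/
lemma altEulerianEGF_eq :
    altEulerianEGF = C RatFunc.X * (altCoeffEGF (RatFunc.X : RatFunc ℚ) - 1) := by
  ext n
  rw [coeff_C_mul, map_sub, altEulerianEGF, altCoeffEGF, coeff_mk, coeff_mk, coeff_one]
  split_ifs with hn
  · simp [hn, altCoeff_zero]
  · rw [altEulerianPoly, altCoeff_eq_sum_perm, map_sum, sub_zero, mul_div_assoc', Finset.mul_sum]
    simp only [map_mul, map_pow, RatFunc.algebraMap_X, pow_succ']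

end AltEulerian

/-- The identity `F(t,u) = t (1 - tan (u(t-1)) - sec (u(t-1))) / (tan (u(t-1)) + sec (u(t-1)) - t)`
of formal power series in `u` over `ℚ(t)`; the first conjunct records that the denominator is
invertible, so that the quotient is genuine. -/
theorem theorem4p2 :
    IsUnit (AltEulerian.tanAddSec - PowerSeries.C (RatFunc.X : RatFunc ℚ)) ∧
    AltEulerian.altEulerianEGF =
      PowerSeries.C (RatFunc.X : RatFunc ℚ) * (1 - AltEulerian.tanAddSec) *
        (AltEulerian.tanAddSec - PowerSeries.C (RatFunc.X : RatFunc ℚ))⁻¹ := by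
  have hX : (1 : RatFunc ℚ) - RatFunc.X ≠ 0 := by
    rw [sub_ne_zero, ← RatFunc.algebraMap_X, ← map_one (algebraMap (Polynomial ℚ) (RatFunc ℚ))]
    exact fun h => Polynomial.X_ne_C 1 (RatFunc.algebraMap_injective ℚ h).symm
  -- The constant term of the denominator is `1 - t`.
  have h0 : PowerSeries.constantCoeff
      (AltEulerian.tanAddSec - PowerSeries.C (RatFunc.X : RatFunc ℚ)) ≠ 0 := by
    simpa [AltEulerian.constantCoeff_tanAddSec] using hX
  refine ⟨PowerSeries.isUnit_iff_constantCoeff.2 (isUnit_iff_ne_zero.2 h0), ?_⟩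
  rw [PowerSeries.eq_mul_inv_iff_mul_eq h0, AltEulerian.altEulerianEGF_eq]
  linear_combination -PowerSeries.C RatFunc.X * AltEulerian.altCoeffEGF_mul_sub_tanAddSec
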